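/- For positive integers $i_1,\dots,i_k$ with $i_1>1$, let $\zeta(i_1,\dots,i_k)=\sum_{n_1>\dots>n_k\ge 1}\frac{1}{n_1^{i_1}\cdots n_k^{i_k}}$ be the multiple zeta value of weight $i_1+\dots+i_k$ and depth $k$. For $1\le k\le n$ let $$E(2n,k)=\sum_{\substack{i_1,\dots,i_k \text{ even positive integers}\\ i_1+\dots+i_k=2n}}\zeta(i_1,\dots,i_k)$$ (all the series that occur converge). Then for all $n\ge 1$, $$\sum_{k=1}^n E(2n,k)=\frac{2(2^{2n-1}-1)(-1)^{n-1}B_{2n}\,\pi^{2n}}{(2n)!},$$ where $B_{2n}$ is the $2n$-th Bernoulli number. Moreover, $$\frac{\pi\sqrt t}{\sin(\pi\sqrt t)}=1+\sum_{n\ge 1}\Big(\sum_{k=1}^n E(2n,k)\Big)t^n$$ for all complex $t$ near $0$ (the left side being given its limit value $1$ at $t=0$); that is, for every $n\ge1$ the sum of all multiple zeta values of weight $2n$ with even arguments is the coefficient of $t^n$ in the power series expansion of $\pi\sqrt t/\sin(\pi\sqrt t)$ at $t=0$. -/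

import Mathlib

open scoped BigOperators Nat

noncomputable section

/-- Index set of the multiple zeta series of depth `k`: the `k`-tuples of integers
`m 0 > m 1 > ⋯ > m (k - 1) ≥ 1`. -/
def MZVIndex (k : ℕ) : Type :=
  {m : Fin k → ℕ // StrictAnti m ∧ ∀ j, 1 ≤ m j}

/-- The general term `1 / (m₁ ^ i₁ ⋯ m_k ^ i_k)` of the multiple zeta series. -/
def mzvTerm {k : ℕ} (i : Fin k → ℕ) (m : MZVIndex k) : ℝ :=
  1 / ∏ j, (m.1 j : ℝ) ^ i j

/-- The multiple zeta value `ζ(i₁, …, i_k)`. -/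
def multipleZetaValue {k : ℕ} (i : Fin k → ℕ) : ℝ :=
  ∑' m : MZVIndex k, mzvTerm i m

/-- All sequences `(i₁, …, i_k)` of positive even integers with `i₁ + ⋯ + i_k = w`. -/
def evenArguments (w k : ℕ) : Finset (Fin k → ℕ) :=
  (Finset.piAntidiag (Finset.univ : Finset (Fin k)) w).filter fun i => ∀ j, 0 < i j ∧ Even (i j)

/-- `evenMZVSum w k` is `E(w, k)`: the sum of all multiple zeta values with even arguments,
weight `w` and depth `k`. -/
def evenMZVSum (w k : ℕ) : ℝ :=
  ∑ i ∈ evenArguments w k, multipleZetaValue i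

/-- The function `π √t / sin (π √t)` of a complex variable `t`, with its removable singularity at
`t = 0` filled in. It does not depend on the branch of the square root. -/
def piSqrtDivSin (t : ℂ) : ℂ :=
  if t = 0 then 1
  else (Real.pi : ℂ) * t ^ (1 / 2 : ℂ) / Complex.sin ((Real.pi : ℂ) * t ^ (1 / 2 : ℂ))

end

/-!
For `t` near `0`, expanding each factor of `∏ (1 - t / m²)⁻¹ = ∏ (1 + ∑_{a ≥ 1} m⁻²ᵃ tᵃ)` and
choosing the finite set of `m` from which a nontrivial term is taken yields the sum of all multiple
zeta values with even arguments, of weight `2n` in the coefficient of `tⁿ`. By Euler's product the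
value is `π√t / sin (π√t)`.

No analysis of the expanded product is needed: its partial products converge coefficientwise, and
so do those of `∏ (1 - X / m²)`, hence the two limits are inverse power series. Only the second one
has to be evaluated, and its coefficients, the elementary symmetric functions of the `-1 / m²`,
are those of an everywhere convergent series. Comparing with the sine series identifies it as
`∑ (-π²)ⁿ Xⁿ / (2n + 1)!`, whose inverse is given by the Bernoulli numbers.
-/

open Filter Topology PowerSeries

/-! ### Maclaurin series -/

section MaclaurinSeries

variable {𝕜 : Type*} [NontriviallyNormedField 𝕜] {p q : 𝕜⟦X⟧} {f g : 𝕜 → 𝕜}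

/-- `f` is analytic at `0`, and `p` is its power series there. This recasts `HasFPowerSeriesAt`,
which speaks of formal multilinear series, in terms of the ring `𝕜⟦X⟧`. -/
def HasMaclaurinSeries (f : 𝕜 → 𝕜) (p : 𝕜⟦X⟧) : Prop :=
  HasFPowerSeriesAt f (FormalMultilinearSeries.ofScalars 𝕜 fun n => coeff n p) 0

theorem hasMaclaurinSeries_iff :
    HasMaclaurinSeries f p ↔ ∀ᶠ t in 𝓝 0, HasSum (fun n => coeff n p * t ^ n) (f t) := by
  simp only [HasMaclaurinSeries, hasFPowerSeriesAt_iff, FormalMultilinearSeries.coeff_ofScalars,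
    smul_eq_mul, mul_comm, zero_add]

theorem exists_hasMaclaurinSeries (hf : AnalyticAt 𝕜 f 0) : ∃ p, HasMaclaurinSeries f p := by
  obtain ⟨s, hs⟩ := hf
  refine ⟨mk s.coeff, hasMaclaurinSeries_iff.2 ?_⟩
  simpa only [hasFPowerSeriesAt_iff, zero_add, smul_eq_mul, mul_comm, coeff_mk] using hs

theorem hasMaclaurinSeries_one : HasMaclaurinSeries (1 : 𝕜 → 𝕜) 1 := by
  refine hasMaclaurinSeries_iff.2 (.of_forall fun t => ?_)
  convert hasSum_single (f := fun n => coeff n (1 : 𝕜⟦X⟧) * t ^ n) 0 fun n hn => ?_ using 1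
  · simp
  · simp [coeff_one, hn]

namespace HasMaclaurinSeries

theorem unique (hp : HasMaclaurinSeries f p) (hq : HasMaclaurinSeries f q) : p = q :=
  PowerSeries.ext <| congrFun <| FormalMultilinearSeries.ofScalars_series_injective 𝕜 𝕜 <|
    HasFPowerSeriesAt.eq_formalMultilinearSeries hp hq

theorem apply_zero (hf : HasMaclaurinSeries f p) : f 0 = coeff 0 p := by
  simpa using (HasFPowerSeriesAt.coeff_zero hf fun _ => 0).symm

theorem eventually_summable_norm (hf : HasMaclaurinSeries f p) :
    ∀ᶠ t in 𝓝 0, Summable fun n => ‖coeff n p * t ^ n‖ := by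
  filter_upwards [Metric.eball_mem_nhds 0 (HasFPowerSeriesAt.radius_pos hf)] with t ht
  simpa [mul_comm] using FormalMultilinearSeries.summable_norm_apply _ ht

variable [CompleteSpace 𝕜]

theorem mul (hf : HasMaclaurinSeries f p) (hg : HasMaclaurinSeries g q) :
    HasMaclaurinSeries (f * g) (p * q) := by
  rw [hasMaclaurinSeries_iff]
  filter_upwards [hasMaclaurinSeries_iff.1 hf, hasMaclaurinSeries_iff.1 hg,
    hf.eventually_summable_norm, hg.eventually_summable_norm] with t hft hgt hp hq
  have hcoeff (n : ℕ) : coeff n (p * q) * t ^ n =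
      ∑ kl ∈ Finset.HasAntidiagonal.antidiagonal n,
        (coeff kl.1 p * t ^ kl.1) * (coeff kl.2 q * t ^ kl.2) := by
    rw [coeff_mul, Finset.sum_mul]
    refine Finset.sum_congr rfl fun kl hkl => ?_
    rw [← Finset.HasAntidiagonal.mem_antidiagonal.1 hkl, pow_add]
    ring
  simp only [hcoeff, Pi.mul_apply, ← hft.tsum_eq, ← hgt.tsum_eq,
    tsum_mul_tsum_eq_tsum_sum_antidiagonal_of_summable_norm hp hq]
  exact (summable_norm_sum_mul_antidiagonal_of_summable_norm hp hq).of_norm.hasSum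

theorem inv (hf : HasMaclaurinSeries f p) (hpq : p * q = 1) : HasMaclaurinSeries f⁻¹ q := by
  have hne : f 0 ≠ 0 := by
    rw [hf.apply_zero]
    exact left_ne_zero_of_mul_eq_one (b := coeff 0 q) (by simpa using congrArg (coeff 0) hpq)
  have hfa : AnalyticAt 𝕜 f 0 := HasFPowerSeriesAt.analyticAt hf
  obtain ⟨r, hr⟩ := exists_hasMaclaurinSeries (hfa.inv hne)
  have hpr : p * r = 1 := by
    refine (hf.mul hr).unique (HasFPowerSeriesAt.congr hasMaclaurinSeries_one ?_)
    filter_upwards [hfa.continuousAt.eventually_ne hne] with t ht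
    exact (mul_inv_cancel₀ ht).symm
  have hqr : q = r := left_inv_eq_right_inv ((mul_comm q p).trans hpq) hpr
  rwa [hqr]

end HasMaclaurinSeries

end MaclaurinSeries

/-! ### The products `∏ (1 + xᵢ X)` and `∏ (1 - xᵢ X)⁻¹` -/

section EsymmSeries

open scoped PowerSeries.WithPiTopology

/-- The generating function of the elementary symmetric functions of a family `x`, which may be
infinite provided that the sums converge. -/
noncomputable def esymmSeries {ι R : Type*} [CommSemiring R] [TopologicalSpace R] (x : ι → R) :
    R⟦X⟧ :=
  mk fun n => ∑' s : {s : Finset ι // s.card = n}, ∏ i ∈ s.1, x i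

variable {ι R : Type*} [NormedCommRing R] [NormOneClass R] [CompleteSpace R] {x : ι → R}

theorem hasProd_one_add_C_mul_X (hx : Summable (‖x ·‖)) :
    HasProd (fun i => 1 + C (x i) * X) (esymmSeries x) := by
  refine hasProd_one_add_of_hasSum_prod ((WithPiTopology.hasSum_iff_hasSum_coeff R).2 fun n => ?_)
  have hcoeff (s : Finset ι) : coeff n (∏ i ∈ s, C (x i) * X) =
      {s : Finset ι | s.card = n}.indicator (fun s => ∏ i ∈ s, x i) s := by
    rw [Finset.prod_mul_distrib, Finset.prod_const, ← map_prod, coeff_C_mul, coeff_X_pow]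
    simp [Set.indicator_apply, eq_comm]
  simp only [hcoeff, esymmSeries, coeff_mk]
  exact hasSum_subtype_iff_indicator.1 ((summable_finsetProd_of_summable_norm hx).subtype _).hasSum

theorem hasSum_coeff_esymmSeries_mul_pow (hx : Summable (‖x ·‖)) (t : R) :
    HasSum (fun n => coeff n (esymmSeries x) * t ^ n) (∏' i, (1 + x i * t)) := by
  have hxt : Summable fun i => ‖x i * t‖ :=
    (hx.mul_right ‖t‖).of_nonneg_of_le (fun _ => norm_nonneg _) fun _ => norm_mul_le _ _
  have hsum : Summable fun s : Finset ι => ∏ i ∈ s, x i * t :=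
    summable_finsetProd_of_summable_norm hxt
  rw [tprod_one_add hsum]
  refine HasSum.sigma ((Equiv.sigmaFiberEquiv Finset.card).hasSum_iff.2 hsum.hasSum) fun n => ?_
  rw [esymmSeries, coeff_mk]
  refine ((summable_finsetProd_of_summable_norm hx).subtype _).hasSum.mul_right (t ^ n)
    |>.congr_fun fun s => ?_
  simp [Finset.prod_mul_distrib, Equiv.sigmaFiberEquiv, s.2]

end EsymmSeries

section GeomTail

variable {R : Type*} [CommSemiring R]

/-- The power series `r X / (1 - r X) = ∑_{a ≥ 1} rᵃ Xᵃ`. -/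
noncomputable def geomTail (r : R) : R⟦X⟧ :=
  mk fun a => if 0 < a then r ^ a else 0

theorem geomTail_zero : geomTail (0 : R) = 0 := by
  ext a
  simp +contextual [geomTail, Nat.ne_of_gt]

theorem one_add_geomTail_mul_one_sub {R : Type*} [CommRing R] (r : R) :
    (1 + geomTail r) * (1 + C (-r) * X) = 1 := by
  have hadd : 1 + geomTail r = rescale r (mk 1) := by
    ext a
    rcases eq_or_ne a 0 with rfl | ha <;> simp [geomTail, coeff_one, Nat.pos_iff_ne_zero, *]
  have hsub : 1 + C (-r) * X = rescale r (1 - X) := by simp [rescale_X, sub_eq_add_neg]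
  rw [hadd, hsub, ← map_mul, mk_one_mul_one_sub_eq_one, map_one]

theorem coeff_prod_geomTail {ι : Type*} [Fintype ι] [DecidableEq ι] (x : ι → R) (n : ℕ) :
    coeff n (∏ j, geomTail (x j)) =
      ∑ a ∈ Finset.piAntidiag Finset.univ n with ∀ j, 0 < a j, ∏ j, x j ^ a j := by
  rw [coeff_prod, Finset.sum_filter]
  refine Finset.sum_equiv Finsupp.equivFunOnFinite (fun a => ?_) fun a _ => ?_
  · simp [Finset.mem_finsuppAntidiag]
  · simp only [geomTail, coeff_mk, Finset.prod_ite_zero, Finset.mem_univ, true_imp_iff]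
    rfl

theorem coeff_prod_geomTail_eq_zero {ι : Type*} (x : ι → R) {n : ℕ} {s : Finset ι}
    (h : n < s.card) : coeff n (∏ i ∈ s, geomTail (x i)) = 0 := by
  have hdvd : (X : R⟦X⟧) ^ s.card ∣ ∏ i ∈ s, geomTail (x i) := by
    rw [← Finset.prod_const]
    exact Finset.prod_dvd_prod_of_dvd _ _ fun i _ => X_dvd_iff.2 (by simp [geomTail])
  exact X_pow_dvd_iff.1 hdvd n h

end GeomTail

/-! ### The Bernoulli expansion of `√X / sinh √X` -/

section Bernoulli

variable (A : Type*) [CommRing A] [Algebra ℚ A]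

/-- The power series `∑ Xⁿ / (2n + 1)!` of `sinh √X / √X`. -/
noncomputable def sinhSqrtDivSqrt : A⟦X⟧ :=
  mk fun n => algebraMap ℚ A (1 / (2 * n + 1)!)

/-- The power series of `√X / sinh √X`, with the Bernoulli numbers in its coefficients; it is the
inverse of `sinhSqrtDivSqrt`. -/
noncomputable def sqrtDivSinhSqrt : A⟦X⟧ :=
  mk fun n => algebraMap ℚ A ((2 - 2 ^ (2 * n)) * bernoulli (2 * n) / (2 * n)!)

theorem bernoulliPowerSeries_mul_exp_sub_exp_neg :
    (2 * bernoulliPowerSeries A - rescale 2 (bernoulliPowerSeries A)) *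
      (exp A - evalNegHom (exp A)) = 2 * X := by
  have hB := bernoulliPowerSeries_mul_exp_sub_one A
  have hB₂ := congrArg (rescale (2 : A)) hB
  have hexp₂ := exp_pow_eq_rescale_exp (A := A) 2
  have hexp_neg := exp_mul_exp_neg_eq_one (A := A)
  rw [Nat.cast_ofNat] at hexp₂
  rw [map_mul, map_sub, map_one, ← hexp₂, rescale_X, map_ofNat] at hB₂
  -- `2x / (eˣ - e⁻ˣ) = 2x / (eˣ - 1) - 2x / (e²ˣ - 1)`
  linear_combination 2 * evalNegHom (exp A) * (exp A + 1) * hB - evalNegHom (exp A) * hB₂ +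
    (2 * X - (2 * bernoulliPowerSeries A - rescale 2 (bernoulliPowerSeries A)) * exp A) * hexp_neg

theorem expand_sqrtDivSinhSqrt :
    expand 2 two_ne_zero (sqrtDivSinhSqrt A) =
      2 * bernoulliPowerSeries A - rescale 2 (bernoulliPowerSeries A) := by
  ext n
  have hcoeff : coeff n (2 * bernoulliPowerSeries A - rescale 2 (bernoulliPowerSeries A)) =
      algebraMap ℚ A ((2 - 2 ^ n) * bernoulli n / n !) := by
    rw [← map_ofNat C 2, map_sub, coeff_C_mul, coeff_rescale]
    simp only [bernoulliPowerSeries, coeff_mk, mul_div_assoc, map_mul, map_sub, map_pow, map_ofNat]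
    ring
  rw [hcoeff]
  rcases n.even_or_odd' with ⟨m, rfl | rfl⟩
  · rw [coeff_expand_mul, sqrtDivSinhSqrt, coeff_mk]
  · rw [coeff_expand_of_not_dvd _ _ _ (by omega)]
    rcases eq_or_ne m 0 with rfl | hm
    · -- `bernoulli 1 ≠ 0`, but its factor `2 - 2 ^ 1` vanishes.
      simp
    · simp [bernoulli_eq_zero_of_odd (odd_two_mul_add_one m) (by omega)]

theorem two_mul_X_mul_expand_sinhSqrtDivSqrt :
    2 * X * expand 2 two_ne_zero (sinhSqrtDivSqrt A) = exp A - evalNegHom (exp A) := by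
  ext n
  rw [mul_assoc, ← map_ofNat C 2, coeff_C_mul, map_sub, evalNegHom, coeff_rescale, coeff_exp]
  rcases n with _ | n
  · simp
  rw [coeff_succ_X_mul]
  rcases n.even_or_odd' with ⟨m, rfl | rfl⟩
  · rw [coeff_expand_mul, sinhSqrtDivSqrt, coeff_mk, (odd_two_mul_add_one m).neg_one_pow]
    ring
  · rw [coeff_expand_of_not_dvd _ _ _ (by omega), Even.neg_one_pow ⟨m + 1, by ring⟩]
    ring

theorem sqrtDivSinhSqrt_mul_sinhSqrtDivSqrt : sqrtDivSinhSqrt A * sinhSqrtDivSqrt A = 1 := by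
  have htwo : IsUnit (2 : A⟦X⟧) := by
    rw [← map_ofNat C 2, ← map_ofNat (algebraMap ℚ A) 2]
    exact ((IsUnit.mk0 (2 : ℚ) two_ne_zero).map (algebraMap ℚ A)).map C
  have hexpand : expand 2 two_ne_zero (sqrtDivSinhSqrt A * sinhSqrtDivSqrt A) = 1 := by
    refine X_mul_cancel (htwo.mul_left_cancel ?_)
    have h := bernoulliPowerSeries_mul_exp_sub_exp_neg A
    rw [← expand_sqrtDivSinhSqrt, ← two_mul_X_mul_expand_sinhSqrtDivSqrt] at h
    rw [map_mul]
    linear_combination h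
  ext n
  rw [← coeff_expand_mul 2 two_ne_zero, hexpand]
  simp [coeff_one]

end Bernoulli

/-! ### Multiple zeta values as coefficients of an infinite product -/

section MultipleZetaValues

theorem mem_evenArguments {w k : ℕ} {i : Fin k → ℕ} :
    i ∈ evenArguments w k ↔ ∑ j, i j = w ∧ ∀ j, 0 < i j ∧ Even (i j) := by
  simp [evenArguments]

theorem sum_evenArguments_two_mul {M : Type*} [AddCommMonoid M] (n k : ℕ)
    (f : (Fin k → ℕ) → M) :
    ∑ i ∈ evenArguments (2 * n) k, f i =
      ∑ a ∈ Finset.piAntidiag Finset.univ n with ∀ j, 0 < a j, f fun j => 2 * a j := by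
  symm
  refine Finset.sum_nbij (fun a j => 2 * a j) (fun a ha => ?_) (fun a _ b _ hab => ?_)
    (fun i hi => ?_) fun _ _ => rfl
  · simp_all [mem_evenArguments, ← Finset.mul_sum]
  · exact funext fun j => Nat.mul_left_cancel two_pos (congrFun hab j)
  · obtain ⟨hsum, hi⟩ := mem_evenArguments.1 hi
    choose a ha using fun j => (hi j).2.two_dvd
    obtain rfl : i = fun j => 2 * a j := funext ha
    refine ⟨a, ?_, rfl⟩
    simp_all [← Finset.mul_sum]

namespace MZVIndex

variable {k : ℕ}

/-- The set of entries of an index of the multiple zeta series. -/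
def toFinset (m : MZVIndex k) : Finset ℕ :=
  Finset.univ.map ⟨m.1, m.2.1.injective⟩

theorem prod_toFinset {M : Type*} [CommMonoid M] (m : MZVIndex k) (f : ℕ → M) :
    ∏ x ∈ m.toFinset, f x = ∏ j, f (m.1 j) := by
  simp [toFinset]

theorem card_toFinset (m : MZVIndex k) : m.toFinset.card = k := by
  simp [toFinset]

theorem mem_toFinset {m : MZVIndex k} {x : ℕ} : x ∈ m.toFinset ↔ ∃ j, m.1 j = x := by
  simp [toFinset]

theorem toFinset_injective : Function.Injective (toFinset (k := k)) := by
  have eq_orderEmb (m : MZVIndex k) (s : Finset ℕ) (hs : s.card = k) (h : m.toFinset = s) :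
      m.1 ∘ Fin.rev = s.orderEmbOfFin hs :=
    Finset.orderEmbOfFin_unique hs (fun j => h ▸ mem_toFinset.2 ⟨j.rev, rfl⟩)
      fun a b hab => m.2.1 (Fin.rev_lt_rev.2 hab)
  intro m m' h
  have hrev := (eq_orderEmb m _ m'.card_toFinset h).trans
    (eq_orderEmb m' _ m'.card_toFinset rfl).symm
  exact Subtype.ext (Fin.rev_surjective.injective_comp_right hrev)

theorem mem_range_toFinset {s : Finset ℕ} :
    s ∈ Set.range (toFinset (k := k)) ↔ s.card = k ∧ 0 ∉ s := by
  constructor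
  · rintro ⟨m, rfl⟩
    refine ⟨m.card_toFinset, fun h => ?_⟩
    obtain ⟨j, hj⟩ := mem_toFinset.1 h
    exact absurd (m.2.2 j) (by simp [hj])
  · rintro ⟨rfl, h0⟩
    have hmem (j : Fin s.card) : s.orderEmbOfFin rfl j ∈ s := s.orderEmbOfFin_mem rfl j
    let m : MZVIndex s.card := ⟨s.orderEmbOfFin rfl ∘ Fin.rev,
      (s.orderEmbOfFin rfl).strictMono.comp_strictAnti Fin.rev_strictAnti,
      fun j => Nat.one_le_iff_ne_zero.2 fun h => h0 (h ▸ hmem j.rev)⟩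
    refine ⟨m, Finset.eq_of_subset_of_card_le (fun x hx => ?_) m.card_toFinset.ge⟩
    obtain ⟨j, rfl⟩ := mem_toFinset.1 hx
    exact hmem j.rev

end MZVIndex

theorem summable_mzvTerm {k : ℕ} {i : Fin k → ℕ} (hi : ∀ j, 2 ≤ i j) : Summable (mzvTerm i) := by
  have hsum : Summable fun m : ℕ => ((m : ℝ) ^ 2)⁻¹ := Real.summable_nat_pow_inv.2 one_lt_two
  have hprod := (summable_finsetProd_of_summable_nonneg (fun m => by positivity) hsum)
    |>.comp_injective (MZVIndex.toFinset_injective (k := k))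
  refine hprod.of_nonneg_of_le (fun m => by unfold mzvTerm; positivity) fun m => ?_
  simp only [mzvTerm, Function.comp_apply, MZVIndex.prod_toFinset, one_div,
    ← Finset.prod_inv_distrib]
  refine Finset.prod_le_prod (fun j _ => by positivity) fun j _ => ?_
  have hm : (1 : ℝ) ≤ m.1 j := by exact_mod_cast m.2.2 j
  gcongr
  exact hi j

theorem summable_mzvTerm_of_mem_evenArguments {w k : ℕ} {i : Fin k → ℕ}
    (hi : i ∈ evenArguments w k) : Summable (mzvTerm i) :=
  summable_mzvTerm fun j =>
    have ⟨hpos, heven⟩ := (mem_evenArguments.1 hi).2 j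
    Nat.le_of_dvd hpos heven.two_dvd

theorem coeff_prod_geomTail_toFinset (n : ℕ) {k : ℕ} (m : MZVIndex k) :
    coeff n (∏ x ∈ m.toFinset, geomTail (((x : ℂ) ^ 2)⁻¹)) =
      ((∑ i ∈ evenArguments (2 * n) k, mzvTerm i m : ℝ) : ℂ) := by
  rw [MZVIndex.prod_toFinset, coeff_prod_geomTail, sum_evenArguments_two_mul, Complex.ofReal_sum]
  simp only [mzvTerm, pow_mul, one_div, inv_pow, Finset.prod_inv_distrib]
  push_cast
  congr!

theorem hasSum_coeff_prod_geomTail_toFinset (n k : ℕ) :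
    HasSum (fun m : MZVIndex k => coeff n (∏ x ∈ m.toFinset, geomTail (((x : ℂ) ^ 2)⁻¹)))
      (evenMZVSum (2 * n) k) := by
  simp only [coeff_prod_geomTail_toFinset, Complex.hasSum_ofReal]
  exact hasSum_sum fun i hi => (summable_mzvTerm_of_mem_evenArguments hi).hasSum

theorem hasSum_coeff_prod_geomTail_of_card_eq (n k : ℕ) :
    HasSum (fun s : Finset ℕ =>
        if s.card = k then coeff n (∏ x ∈ s, geomTail (((x : ℂ) ^ 2)⁻¹)) else 0)
      (evenMZVSum (2 * n) k) := by
  refine ((MZVIndex.toFinset_injective (k := k)).hasSum_iff fun s hs => ?_).1 ?_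
  · simp only [MZVIndex.mem_range_toFinset, not_and, not_not] at hs
    -- A set containing `0` contributes nothing, since `(0 ^ 2)⁻¹ = 0`.
    refine ite_eq_right_iff.2 fun hk => ?_
    rw [Finset.prod_eq_zero (hs hk) (by simp [geomTail_zero]), map_zero]
  · simpa only [Function.comp_def, MZVIndex.card_toFinset, if_true] using
      hasSum_coeff_prod_geomTail_toFinset n k

/-- The generating function of the sums of all multiple zeta values of weight `2n` with even
arguments, with constant term `1` for the empty sequence of arguments. -/
noncomputable def evenMZVSeries : ℂ⟦X⟧ :=
  mk fun n => if n = 0 then 1 else ((∑ k ∈ Finset.Icc 1 n, evenMZVSum (2 * n) k : ℝ) : ℂ)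

theorem hasSum_coeff_prod_geomTail (n : ℕ) :
    HasSum (fun s : Finset ℕ => coeff n (∏ x ∈ s, geomTail (((x : ℂ) ^ 2)⁻¹)))
      (coeff n evenMZVSeries) := by
  rcases eq_or_ne n 0 with rfl | hn
  · simp only [evenMZVSeries, coeff_mk, if_true]
    convert hasSum_single (∅ : Finset ℕ) fun s hs => ?_ using 1
    · simp
    · exact coeff_prod_geomTail_eq_zero _ (Finset.card_pos.2 (Finset.nonempty_iff_ne_empty.2 hs))
  · rw [evenMZVSeries, coeff_mk, if_neg hn, Complex.ofReal_sum]
    refine (hasSum_sum fun k _ => hasSum_coeff_prod_geomTail_of_card_eq n k).congr_fun fun s => ?_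
    rw [Finset.sum_ite_eq]
    split_ifs with hs
    · rfl
    · rcases s.eq_empty_or_nonempty with rfl | hne
      · simp [coeff_one, hn]
      · exact coeff_prod_geomTail_eq_zero _ (by
          simpa [Nat.one_le_iff_ne_zero, hne.ne_empty] using hs)

end MultipleZetaValues

/-! ### The Euler product -/

section EulerProduct

open scoped PowerSeries.WithPiTopology

theorem summable_norm_neg_inv_sq : Summable fun m : ℕ => ‖-((m : ℂ) ^ 2)⁻¹‖ := by
  simp

theorem evenMZVSeries_mul_esymmSeries :
    evenMZVSeries * esymmSeries (fun m : ℕ => -((m : ℂ) ^ 2)⁻¹) = 1 := by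
  have hgeom : HasProd (fun m : ℕ => 1 + geomTail (((m : ℂ) ^ 2)⁻¹)) evenMZVSeries :=
    hasProd_one_add_of_hasSum_prod
      ((WithPiTopology.hasSum_iff_hasSum_coeff ℂ).2 hasSum_coeff_prod_geomTail)
  refine (hgeom.mul (hasProd_one_add_C_mul_X summable_norm_neg_inv_sq)).unique ?_
  simpa only [one_add_geomTail_mul_one_sub] using hasProd_one

theorem inv_piSqrtDivSin_sq (z : ℂ) :
    (piSqrtDivSin (z ^ 2))⁻¹ = if z = 0 then 1 else Complex.sin (Real.pi * z) / (Real.pi * z) := by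
  rcases eq_or_ne z 0 with rfl | hz
  · simp [piSqrtDivSin]
  · have hsq : ((z ^ 2) ^ (1 / 2 : ℂ)) ^ 2 = z ^ 2 := by simp
    rw [piSqrtDivSin, if_neg (pow_ne_zero 2 hz), inv_div, if_neg hz]
    rcases sq_eq_sq_iff_eq_or_eq_neg.1 hsq with h | h <;> rw [h]
    rw [mul_neg, Complex.sin_neg, neg_div_neg_eq]

theorem tprod_one_sub_sq_div_sq (z : ℂ) :
    ∏' m : ℕ, (1 + -((m : ℂ) ^ 2)⁻¹ * z ^ 2) = (piSqrtDivSin (z ^ 2))⁻¹ := by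
  rw [inv_piSqrtDivSin_sq]
  split_ifs with hz
  · simp [hz]
  have hpi : (Real.pi : ℂ) * z ≠ 0 := mul_ne_zero (by exact_mod_cast Real.pi_ne_zero) hz
  have hmul : Multipliable fun m : ℕ => 1 + -((m : ℂ) ^ 2)⁻¹ * z ^ 2 :=
    multipliable_one_add_of_summable <| by
      simpa only [norm_mul] using summable_norm_neg_inv_sq.mul_right ‖z ^ 2‖
  refine tendsto_nhds_unique (hmul.hasProd.tendsto_prod_nat.comp (tendsto_add_atTop_nat 1))
    (((Complex.tendsto_euler_sin_prod z).div_const (Real.pi * z)).congr fun N => ?_)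
  rw [mul_div_cancel_left₀ _ hpi, Function.comp_apply, Finset.prod_range_succ']
  simp [div_eq_inv_mul, sub_eq_add_neg]

theorem hasMaclaurinSeries_inv_piSqrtDivSin_esymm :
    HasMaclaurinSeries piSqrtDivSin⁻¹ (esymmSeries fun m : ℕ => -((m : ℂ) ^ 2)⁻¹) := by
  refine hasMaclaurinSeries_iff.2 (.of_forall fun t => ?_)
  obtain ⟨z, rfl⟩ := IsAlgClosed.exists_pow_nat_eq t two_pos
  rw [Pi.inv_apply, ← tprod_one_sub_sq_div_sq]
  exact hasSum_coeff_esymmSeries_mul_pow summable_norm_neg_inv_sq _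

theorem hasMaclaurinSeries_inv_piSqrtDivSin_rescale :
    HasMaclaurinSeries piSqrtDivSin⁻¹ (rescale (-(Real.pi : ℂ) ^ 2) (sinhSqrtDivSqrt ℂ)) := by
  refine hasMaclaurinSeries_iff.2 (.of_forall fun t => ?_)
  obtain ⟨z, rfl⟩ := IsAlgClosed.exists_pow_nat_eq t two_pos
  have hterm (n : ℕ) : coeff n (rescale (-(Real.pi : ℂ) ^ 2) (sinhSqrtDivSqrt ℂ)) * (z ^ 2) ^ n =
      (-1) ^ n * (Real.pi * z) ^ (2 * n) / (2 * n + 1)! := by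
    simp only [sinhSqrtDivSqrt, coeff_rescale, coeff_mk, one_div, map_inv₀, map_natCast]
    ring
  simp only [hterm, Pi.inv_apply, inv_piSqrtDivSin_sq]
  split_ifs with hz
  · convert hasSum_single 0 fun n hn => ?_ using 1
    · simp
    · simp [hz, hn]
  · have hpi : (Real.pi : ℂ) * z ≠ 0 := mul_ne_zero (by exact_mod_cast Real.pi_ne_zero) hz
    refine ((Complex.hasSum_sin (Real.pi * z)).div_const (Real.pi * z)).congr_fun fun n => ?_
    rw [eq_div_iff hpi, pow_succ]
    ring

theorem evenMZVSeries_eq_rescale :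
    evenMZVSeries = rescale (-(Real.pi : ℂ) ^ 2) (sqrtDivSinhSqrt ℂ) := by
  have hprod := evenMZVSeries_mul_esymmSeries
  rw [hasMaclaurinSeries_inv_piSqrtDivSin_esymm.unique
    hasMaclaurinSeries_inv_piSqrtDivSin_rescale] at hprod
  refine left_inv_eq_right_inv hprod ?_
  rw [← map_mul, mul_comm, sqrtDivSinhSqrt_mul_sinhSqrtDivSqrt, map_one]

theorem hasMaclaurinSeries_piSqrtDivSin : HasMaclaurinSeries piSqrtDivSin evenMZVSeries := by
  simpa using hasMaclaurinSeries_inv_piSqrtDivSin_esymm.inv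
    ((mul_comm _ _).trans evenMZVSeries_mul_esymmSeries)

theorem sum_evenMZVSum_eq {n : ℕ} (hn : 1 ≤ n) :
    ∑ k ∈ Finset.Icc 1 n, evenMZVSum (2 * n) k =
      2 * ((2 : ℝ) ^ (2 * n - 1) - 1) * (-1 : ℝ) ^ (n - 1) * (bernoulli (2 * n) : ℝ) *
        Real.pi ^ (2 * n) / ((2 * n)! : ℝ) := by
  have h := congrArg (coeff n) evenMZVSeries_eq_rescale
  rw [evenMZVSeries, sqrtDivSinhSqrt, coeff_rescale, coeff_mk, coeff_mk,
    if_neg (Nat.one_le_iff_ne_zero.1 hn), eq_ratCast] at h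
  apply Complex.ofReal_injective
  rw [h]
  obtain ⟨m, rfl⟩ := Nat.exists_eq_add_of_le' hn
  have hexp : 2 * (m + 1) - 1 = 2 * m + 1 := by omega
  rw [hexp, Nat.add_sub_cancel]
  push_cast
  ring

end EulerProduct

theorem mainTheorem5 :
    (∀ n k : ℕ, 1 ≤ k → k ≤ n → ∀ i ∈ evenArguments (2 * n) k, Summable (mzvTerm i)) ∧
    (∀ n : ℕ, 1 ≤ n →
      ∑ k ∈ Finset.Icc 1 n, evenMZVSum (2 * n) k =
        2 * ((2 : ℝ) ^ (2 * n - 1) - 1) * (-1 : ℝ) ^ (n - 1) * (bernoulli (2 * n) : ℝ) *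
          Real.pi ^ (2 * n) / ((2 * n)! : ℝ)) ∧
    HasFPowerSeriesAt piSqrtDivSin
      (FormalMultilinearSeries.ofScalars ℂ fun n : ℕ =>
        if n = 0 then (1 : ℂ)
        else ((∑ k ∈ Finset.Icc 1 n, evenMZVSum (2 * n) k : ℝ) : ℂ)) 0 := by
  refine ⟨fun n k _ _ i hi => summable_mzvTerm_of_mem_evenArguments hi,
    fun n hn => sum_evenMZVSum_eq hn, ?_⟩
  simpa only [HasMaclaurinSeries, evenMZVSeries, coeff_mk] using hasMaclaurinSeries_piSqrtDivSin
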